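/- Let $\mathcal M=(M,<,P_i,E_j,R_{n,j})_{i\in I,\,j\in J,\,n\in\mathbb Z}$ be a structure in which $<$ is a linear order on $M$, each $P_i$ is a subset of $M$, and each $E_j$ is a convex equivalence relation on $M$ (an equivalence relation with $<$-convex classes). Suppose that every subset of $M$ that is definable without parameters in $\mathcal M$ is one of the $P_i$, and that every convex equivalence relation on $M$ that is definable without parameters in $\mathcal M$ is one of the $E_j$. For a convex equivalence relation $E$, $y\in M$ and $n\in\mathbb Z$ let $S^n_E(y)$ be the $n$-th consecutive $E$-class succeeding the class $[y]_E$ if $n>0$, the class $[y]_E$ itself if $n=0$, and the $|n|$-th consecutive $E$-class preceding $[y]_E$ if $n<0$; put $S^n_E(y)=\emptyset$ if no such class exists. Write $x<S^n_E(y)$ if $S^n_E(y)\neq\emptyset$ and $x<z$ for all $z\in S^n_E(y)$, and write $x\leqslant S^n_E(y)$ if $x<S^n_E(y)$ or $x\in S^n_E(y)$. Suppose that for all $j\in J$ and $n\in\mathbb Z$ the binary relation $R_{n,j}(x,y)$ is $x\leqslant S^n_{E_j}(y)$ if $n\geqslant 0$ and $x<S^n_{E_j}(y)$ if $n<0$.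 Then the complete first-order theory of $\mathcal M$ eliminates quantifiers: every formula is equivalent modulo it to a quantifier-free formula in the same free variables. -/

import Mathlib

open FirstOrder

/-- A convex equivalence relation on a linear order: an equivalence relation all of whose classes
are convex. -/
structure IsConvexEquiv {M : Type*} [LinearOrder M] (r : M → M → Prop) : Prop where
  equivalence : Equivalence r
  convex : ∀ x, Set.OrdConnected {y | r x y}

section Successors

variable {M : Type*} [LinearOrder M]

/-- For a convex equivalence relation `r`: the class of `y` is the immediate successor of the
class of `x`. -/
def NextClass (r : M → M → Prop) (x y : M) : Prop :=
  x < y ∧ ¬ r x y ∧ ∀ z, x < z → z < y → r x z ∨ r z y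

/-- The `n`-th consecutive `r`-class succeeding the class of `x` exists and contains `y`
(for `n = 0`: `y` is in the class of `x`). -/
def SuccClassNat (r : M → M → Prop) : ℕ → M → M → Prop
  | 0, x, y => r x y
  | n + 1, x, y => ∃ z, SuccClassNat r n x z ∧ NextClass r z y

/-- `S^N_r(x, y)` for an integer `N`; for `N < 0` it is `S^{-N}_r(y, x)`. -/
def SuccClass (r : M → M → Prop) (N : ℤ) (x y : M) : Prop :=
  if 0 ≤ N then SuccClassNat r N.toNat x y else SuccClassNat r (-N).toNat y x

/-- `x < S^N_r(y)`: the class `S^N_r(y)` exists and all its elements are above `x`. -/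
def LtSucc (r : M → M → Prop) (N : ℤ) (x y : M) : Prop :=
  (∃ z, SuccClass r N y z) ∧ ∀ z, SuccClass r N y z → x < z

/-- `x ≤ S^N_r(y)`: either `x < S^N_r(y)` or `x` belongs to the class `S^N_r(y)`. -/
def LeSucc (r : M → M → Prop) (N : ℤ) (x y : M) : Prop :=
  LtSucc r N x y ∨ SuccClass r N y x

end Successors

/-- The relation symbols `<`, `P_i` (unary), `E_j` (binary) and `R_{n,j}` (binary, `n ∈ ℤ`). -/
inductive CcelSuccRel (I : Type*) (J : Type*) : ℕ → Type _
  | lt : CcelSuccRel I J 2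
  | P (i : I) : CcelSuccRel I J 1
  | E (j : J) : CcelSuccRel I J 2
  | R (n : ℤ) (j : J) : CcelSuccRel I J 2

/-- The relational language `{<} ∪ {P_i} ∪ {E_j} ∪ {R_{n,j}}`. -/
def ccelSuccLanguage (I : Type*) (J : Type*) : Language where
  Functions := fun _ => Empty
  Relations := CcelSuccRel I J

/-- The interpretation of the symbol `<`. -/
def ltInterp (I J M : Type*) [(ccelSuccLanguage I J).Structure M] (x y : M) : Prop :=
  Language.Structure.RelMap (L := ccelSuccLanguage I J) CcelSuccRel.lt ![x, y]

/-- The interpretation of the symbol `P_i`. -/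
def PInterp {I : Type*} (J M : Type*) [(ccelSuccLanguage I J).Structure M] (i : I) : Set M :=
  {x | Language.Structure.RelMap (L := ccelSuccLanguage I J) (CcelSuccRel.P i) ![x]}

/-- The interpretation of the symbol `E_j`. -/
def EInterp (I : Type*) {J : Type*} (M : Type*) [(ccelSuccLanguage I J).Structure M] (j : J)
    (x y : M) : Prop :=
  Language.Structure.RelMap (L := ccelSuccLanguage I J) (CcelSuccRel.E j) ![x, y]

/-- The interpretation of the symbol `R_{n,j}`. -/
def RInterp (I : Type*) {J : Type*} (M : Type*) [(ccelSuccLanguage I J).Structure M] (n : ℤ)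
    (j : J) (x y : M) : Prop :=
  Language.Structure.RelMap (L := ccelSuccLanguage I J) (CcelSuccRel.R n j) ![x, y]

/-- `(M, <, P_i, E_j, R_{n,j})` is a linearly ordered structure in which the `E_j` are convex
equivalence relations, all unary sets and all convex equivalence relations that are definable
without parameters in the structure are named by the `P_i` and the `E_j`, and `R_{n,j}` is
`x ≤ S^n_{E_j}(y)` for `n ≥ 0` and `x < S^n_{E_j}(y)` for `n < 0`. -/
structure IsNamedCcelSucc (I J : Type*) (M : Type*) [LinearOrder M]
    [(ccelSuccLanguage I J).Structure M] : Prop where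
  lt_iff : ∀ x y : M, ltInterp I J M x y ↔ x < y
  isConvexEquiv : ∀ j : J, IsConvexEquiv (EInterp I M j)
  R_nonneg : ∀ (n : ℤ) (j : J), 0 ≤ n →
    ∀ x y : M, RInterp I M n j x y ↔ LeSucc (EInterp I M j) n x y
  R_neg : ∀ (n : ℤ) (j : J), n < 0 →
    ∀ x y : M, RInterp I M n j x y ↔ LtSucc (EInterp I M j) n x y
  named_unary : ∀ s : Set M, (∅ : Set M).Definable₁ (ccelSuccLanguage I J) s →
    ∃ i : I, PInterp J M i = s
  named_convexEquiv : ∀ r : M → M → Prop, IsConvexEquiv r →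
    (∅ : Set M).Definable₂ (ccelSuccLanguage I J) {p : M × M | r p.1 p.2} →
    ∃ j : J, EInterp I M j = r

/-- A theory eliminates quantifiers: modulo the theory, every formula in finitely many free
variables is equivalent to a quantifier-free formula in the same free variables. -/
def EliminatesQuantifiers {L : Language} (T : L.Theory) : Prop :=
  ∀ (n : ℕ) (φ : L.Formula (Fin n)), ∃ ψ : L.Formula (Fin n), ψ.IsQF ∧ T.Iff φ ψ

/-! Call `A` good if it is definable, the sets `A x = {z | A x z}` are initial segments growing with
`x`, and `A` is local: in a long enough sequence of strictly growing segments `A (x i)`, told apart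
by points `z i`, the `x i` cannot all lie on one side of all the `z i`.

Good relations absorb quantifiers. In a conjunction of conditions on `z`, only the least segment `B
y` that must contain `z` and the greatest segment `A x` that must omit it matter, and "`P` meets `B
y \ A x`" is the negation of `Separated P A B`, which is again good (`IsLocalRel.separated`). Hence
every formula is a Boolean combination of definable unary predicates and good relations
(`boolComb_realize`).

Good relations are in turn quantifier-free. For `x < z` replace `A` by `F x z := z ≤ x ∨ A x z`. The
segment `F x` is a union of classes of the definable convex equivalence `kernelRel F`, and locality
bounds the number of classes between `x` and the end of `F x` (`kernelRel_chain_bounded`). So `F x`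
ends with the `n`-th class after that of `x`, for one of boundedly many `n`; a named unary predicate
of `x` detects this `n`, and `F x z` becomes the named relation `z ≤ S^n(x)`. The dual `¬ A z x`
settles `z < x`. -/

namespace CcelSucc

/-! ### Monotone local relations and their closure properties. -/

section Order

variable {M : Type*}

/-- The sequences `x 0, x 1, …` and `z 0, z 1, …` witness that the segments `A (x i)`, for
`i ≤ N + 1`, are pairwise distinct. -/
def Interlaced (A : M → M → Prop) (N : ℕ) (x z : ℕ → M) : Prop :=
  ∀ i ≤ N, ¬ A (x i) (z i) ∧ A (x (i + 1)) (z i)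

theorem Interlaced.shift {A : M → M → Prop} {N N' s : ℕ} {x z : ℕ → M}
    (h : Interlaced A N x z) (hs : s + N' ≤ N) :
    Interlaced A N' (fun i => x (s + i)) (fun i => z (s + i)) :=
  fun i hi => h (s + i) (by omega)

variable [LinearOrder M]

/-- `A x` is an initial segment for every `x`, and it grows with `x`. -/
def IsMonotoneRel (A : M → M → Prop) : Prop :=
  ∀ ⦃x x' z z' : M⦄, x ≤ x' → z' ≤ z → A x z → A x' z'

/-- Long interlaced sequences of `A` cannot lie on opposite sides of a point. -/
def IsLocalRel (A : M → M → Prop) : Prop :=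
  ∃ N, ∀ x z, Interlaced A N x z → z 0 < x (N + 1) ∧ x 0 < z N

theorem Interlaced.lt_succ {A : M → M → Prop} (hA : IsMonotoneRel A) {N : ℕ} {x z : ℕ → M}
    (h : Interlaced A N x z) {i : ℕ} (hi : i ≤ N) : x i < x (i + 1) :=
  lt_of_not_ge fun hle => (h i hi).1 (hA hle le_rfl (h i hi).2)

theorem Interlaced.left_le {A : M → M → Prop} (hA : IsMonotoneRel A) {N : ℕ} {x z : ℕ → M}
    (h : Interlaced A N x z) {i j : ℕ} (hij : i ≤ j) (hj : j ≤ N + 1) : x i ≤ x j := by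
  induction j, hij using Nat.le_induction with
  | base => exact le_rfl
  | succ j _ ih => exact (ih (by omega)).trans (h.lt_succ hA (by omega)).le

theorem Interlaced.right_le {A : M → M → Prop} (hA : IsMonotoneRel A) {N : ℕ} {x z : ℕ → M}
    (h : Interlaced A N x z) {i j : ℕ} (hij : i ≤ j) (hj : j ≤ N) : z i ≤ z j := by
  induction j, hij using Nat.le_induction with
  | base => exact le_rfl
  | succ j _ ih =>
    refine (ih (by omega)).trans (le_of_not_ge fun hle => ?_)
    exact (h (j + 1) hj).1 (hA le_rfl hle (h j (by omega)).2)

theorem IsMonotoneRel.dual {A : M → M → Prop} (hA : IsMonotoneRel A) :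
    IsMonotoneRel fun x z => ¬ A z x :=
  fun _ _ _ _ hx hz h h' => h (hA hz hx h')

/-- Passing to the dual exchanges the two sequences up to a shift by one, which costs one extra
step. -/
theorem IsLocalRel.dual {A : M → M → Prop} (hA : IsMonotoneRel A) (h : IsLocalRel A) :
    IsLocalRel fun x z => ¬ A z x := by
  obtain ⟨N, hN⟩ := h
  refine ⟨N + 1, fun u v huv => ?_⟩
  have hil : Interlaced A N v fun i => u (i + 1) := fun i hi =>
    ⟨(huv i (by omega)).2, not_not.1 (huv (i + 1) (by omega)).1⟩
  have := hN _ _ hil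
  have h01 := huv.left_le hA.dual (Nat.le_succ 0) (by omega)
  have h12 := huv.left_le hA.dual (Nat.le_succ (N + 1)) (by omega)
  exact ⟨this.2.trans_le h12, h01.trans_lt this.1⟩

/-- The set of `y` with no element of `P` in `B y \ A x`. -/
def Separated (P : M → Prop) (A B : M → M → Prop) (x y : M) : Prop :=
  ¬ ∃ z, P z ∧ B y z ∧ ¬ A x z

theorem IsMonotoneRel.separated {P : M → Prop} {A B : M → M → Prop} (hA : IsMonotoneRel A)
    (hB : IsMonotoneRel B) : IsMonotoneRel (Separated P A B) :=
  fun _ _ _ _ hx hy h ⟨z, hP, hz, hz'⟩ =>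
    h ⟨z, hP, hB hy le_rfl hz, fun hz'' => hz' (hA hx le_rfl hz'')⟩

/-- Witnesses `p i` in `P ∩ B (y i) \ A (x i)` interlace with `x` for `A` and, shifted by one, with
`y` for `B`. Locality of `A` compares `x` with `p`, locality of `B` compares `p` with `y`; composing
them compares `x` with `y`. -/
theorem IsLocalRel.separated {P : M → Prop} {A B : M → M → Prop} (hA : IsMonotoneRel A)
    (hB : IsMonotoneRel B) (hA' : IsLocalRel A) (hB' : IsLocalRel B) :
    IsLocalRel (Separated P A B) := by
  obtain ⟨N₁, h₁⟩ := hA'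
  obtain ⟨N₂, h₂⟩ := hB'
  refine ⟨N₁ + N₂ + 1, fun x y hxy => ?_⟩
  have hp : ∀ i, ∃ p, i ≤ N₁ + N₂ + 1 → P p ∧ B (y i) p ∧ ¬ A (x i) p := fun i => by
    by_cases hi : i ≤ N₁ + N₂ + 1
    · obtain ⟨p, hp⟩ := not_not.1 (hxy i hi).1
      exact ⟨p, fun _ => hp⟩
    -- Filler value outside the relevant range.
    · exact ⟨x 0, fun h => absurd h hi⟩
  choose p hp using hp
  have hpA : ∀ i ≤ N₁ + N₂ + 1, A (x (i + 1)) (p i) := fun i hi => by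
    by_contra hA
    exact (hxy i hi).2 ⟨p i, (hp i hi).1, (hp i hi).2.1, hA⟩
  have hilA : Interlaced A (N₁ + N₂ + 1) x p := fun i hi => ⟨(hp i hi).2.2, hpA i hi⟩
  have hilB : Interlaced B (N₁ + N₂) y fun i => p (i + 1) := fun i hi => by
    refine ⟨fun hBi => ?_, (hp (i + 1) (by omega)).2.1⟩
    exact (hxy i (by omega)).2
      ⟨p (i + 1), (hp _ (by omega)).1, hBi, (hp (i + 1) (by omega)).2.2⟩
  have hm := hA.separated (P := P) hB
  constructor
  -- `y 0 < p (N₂ + 1)` by locality of `B`, and `p (N₂ + 1) < x (N₁ + N₂ + 2)` by locality of `A`.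
  · have h₃ := (h₁ _ _ (hilA.shift (s := N₂ + 1) (N' := N₁) (by omega))).1
    have h₄ := (h₂ _ _ (hilB.shift (s := 0) (N' := N₂) (by omega))).2
    simp only [zero_add, add_zero] at h₃ h₄
    exact (h₄.trans h₃).trans_le (hxy.left_le hm (by omega) (by omega))
  -- `x 0 < p N₁ ≤ p (N₁ + 1) < y (N₁ + N₂ + 1)`.
  · have h₃ := (h₁ _ _ (hilA.shift (s := 0) (N' := N₁) (by omega))).2
    have h₄ := (h₂ _ _ (hilB.shift (s := N₁) (N' := N₂) (by omega))).1
    have h₅ := hilA.right_le hA (Nat.le_succ N₁) (by omega)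
    simp only [zero_add, add_zero] at h₃ h₄
    exact ((h₃.trans_le h₅).trans h₄).trans_le (hxy.right_le hm (by omega) (by omega))

theorem isLocalRel_le : IsLocalRel fun x z : M => z ≤ x :=
  ⟨1, fun _ _ h => ⟨(h 0 (by omega)).2.trans_lt
    ((not_le.1 (h 1 le_rfl).1).trans_le (h 1 le_rfl).2),
    (not_le.1 (h 0 (by omega)).1).trans_le
      ((h 0 (by omega)).2.trans (not_le.1 (h 1 le_rfl).1).le)⟩⟩

theorem isMonotoneRel_of_convexEquiv {r : M → M → Prop} (hr : IsConvexEquiv r) :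
    IsMonotoneRel fun x z => z ≤ x ∨ r x z := by
  intro x x' z z' hx hz h
  rcases le_or_gt z' x' with h' | h'
  · exact Or.inl h'
  rcases h with h | h
  · exact absurd (hz.trans (h.trans hx)) (not_le.2 h')
  · have h₁ : r x x' := (hr.convex x).out (hr.equivalence.refl x) h ⟨hx, h'.le.trans hz⟩
    have h₂ : r x z' := (hr.convex x).out (hr.equivalence.refl x) h ⟨hx.trans h'.le, hz⟩
    exact Or.inr (hr.equivalence.trans (hr.equivalence.symm h₁) h₂)

/-- If `x 2 ≤ z 0`, then `x 1` and `x 2` lie in one class by convexity, so their segments coincide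
and `z 1` cannot tell them apart. -/
theorem isLocalRel_of_convexEquiv {r : M → M → Prop} (hr : IsConvexEquiv r) :
    IsLocalRel fun x z => z ≤ x ∨ r x z := by
  refine ⟨1, fun x z h => ?_⟩
  have hm := isMonotoneRel_of_convexEquiv hr
  have h₀ := h 0 (by omega)
  have h₁ := h 1 le_rfl
  simp only [not_or, not_le, zero_add] at h₀ h₁
  refine ⟨lt_of_not_ge fun hle => ?_, h₀.1.1.trans_le (h.right_le hm zero_le_one le_rfl)⟩
  have h₂ := h.lt_succ hm le_rfl
  have h₃ : r (x 1) (x 2) := by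
    rcases h₀.2 with h' | h'
    · exact absurd (h'.trans_lt h₂) (not_lt.2 hle)
    · exact (hr.convex _).out (hr.equivalence.refl _) h' ⟨h₂.le, hle⟩
  rcases h₁.2 with h' | h'
  · exact h₁.1.2 ((hr.convex _).out (hr.equivalence.refl _) h₃ ⟨h₁.1.1.le, h'⟩)
  · exact h₁.1.2 (hr.equivalence.trans h₃ h')

/-! ### The kernel of a monotone relation and the bound on its classes. -/

/-- The coarsest equivalence relation such that `F` is invariant under it in both arguments. -/
def kernelRel (F : M → M → Prop) (x y : M) : Prop :=
  (∀ w, F x w ↔ F y w) ∧ ∀ c, F c x ↔ F c y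

/-- Convexity is a squeeze: `F` is increasing in its first argument and decreasing in its second. -/
theorem isConvexEquiv_kernelRel {F : M → M → Prop} (hF : IsMonotoneRel F) :
    IsConvexEquiv (kernelRel F) where
  equivalence :=
    ⟨fun _ => ⟨fun _ => Iff.rfl, fun _ => Iff.rfl⟩,
      fun h => ⟨fun w => (h.1 w).symm, fun c => (h.2 c).symm⟩,
      fun h h' => ⟨fun w => (h.1 w).trans (h'.1 w), fun c => (h.2 c).trans (h'.2 c)⟩⟩
  convex x := ⟨fun y hy z hz w hw => by
    refine ⟨fun u => (hy.1 u).trans ⟨hF hw.1 le_rfl, fun h => ?_⟩,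
      fun c => (hz.2 c).trans ⟨hF le_rfl hw.2, fun h => ?_⟩⟩
    · exact (hy.1 u).1 ((hz.1 u).2 (hF hw.2 le_rfl h))
    · exact (hz.2 c).1 ((hy.2 c).2 (hF le_rfl hw.1 h))⟩

theorem exists_increasing_selection (p : ℕ → Prop) (m : ℕ) :
    (∃ f : ℕ → ℕ, (∀ i < m, f i < 2 * m ∧ p (f i)) ∧ ∀ i, i + 1 < m → f i < f (i + 1)) ∨
    ∃ f : ℕ → ℕ, (∀ i < m, f i < 2 * m ∧ ¬ p (f i)) ∧ ∀ i, i + 1 < m → f i < f (i + 1) := by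
  classical
  have key : ∀ (q : ℕ → Prop) [DecidablePred q], m ≤ ((Finset.range (2 * m)).filter q).card →
      ∃ f : ℕ → ℕ, (∀ i < m, f i < 2 * m ∧ q (f i)) ∧ ∀ i, i + 1 < m → f i < f (i + 1) := by
    intro q _ hq
    obtain ⟨t, ht, htm⟩ := Finset.exists_subset_card_eq hq
    refine ⟨fun i => if h : i < m then t.orderEmbOfFin htm ⟨i, h⟩ else 0, fun i hi => ?_,
      fun i hi => ?_⟩
    · have := ht (t.orderEmbOfFin_mem htm ⟨i, hi⟩)
      simpa [hi] using this
    · have hi' : i < m := by omega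
      simp [hi, hi']
  have hcard := Finset.card_filter_add_card_filter_not (s := Finset.range (2 * m)) p
  rw [Finset.card_range] at hcard
  rcases le_total m ((Finset.range (2 * m)).filter p).card with h | h
  · exact Or.inl (key p h)
  · exact Or.inr (key (fun i => ¬ p i) (by omega))

/-- Each step of the chain changes `F` in its first or in its second argument. By pigeonhole `N + 2`
steps are of the same kind, and these yield an interlaced sequence to which locality applies. -/
theorem kernelRel_chain_bounded {F : M → M → Prop} (hF : IsMonotoneRel F) {N : ℕ}
    (hN : ∀ x z, Interlaced F N x z → z 0 < x (N + 1)) (y : ℕ → M)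
    (hlt : ∀ i < 2 * (N + 2), y i < y (i + 1) ∧ ¬ kernelRel F (y i) (y (i + 1))) :
    ¬ F (y 0) (y (2 * (N + 2))) := by
  intro h0
  have hle : ∀ {i j}, i ≤ j → j ≤ 2 * (N + 2) → y i ≤ y j := by
    intro i j hij hj
    induction j, hij using Nat.le_induction with
    | base => exact le_rfl
    | succ j _ ih => exact (ih (by omega)).trans (hlt j (by omega)).1.le
  rcases exists_increasing_selection (fun i => ∀ w, F (y i) w ↔ F (y (i + 1)) w) (N + 2) with
    ⟨f, hf, hf'⟩ | ⟨f, hf, hf'⟩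
  -- The second argument matters: segments `F (c j)` end between consecutive `y`'s. Locality pushes
  -- `c (N + 1)` above `y 0`, so its segment contains that of `y 0` and hence the whole chain.
  · have hc : ∀ j, ∃ c, j < N + 2 → F c (y (f j)) ∧ ¬ F c (y (f j + 1)) := by
      intro j
      by_cases hj : j < N + 2
      · have := (hlt _ (hf j hj).1).2
        simp only [kernelRel, not_and, not_forall] at this
        obtain ⟨c, hc⟩ := this (hf j hj).2
        refine ⟨c, fun _ => ?_⟩
        have : F c (y (f j + 1)) → F c (y (f j)) := hF le_rfl (hlt _ (hf j hj).1).1.le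
        tauto
      · exact ⟨y 0, fun h => absurd h hj⟩
    choose c hc using hc
    have := hN c (fun j => y (f j + 1)) fun i hi => ⟨(hc i (by omega)).2,
      hF le_rfl (hle (hf' i (by omega)) (hf (i + 1) (by omega)).1.le) (hc (i + 1) (by omega)).1⟩
    refine (hc (N + 1) (by omega)).2
      (hF ((hle (Nat.zero_le _) ?_).trans this.le) (hle ?_ le_rfl) h0)
    · exact (hf 0 (by omega)).1
    · exact (hf (N + 1) (by omega)).1
  -- The first argument matters: locality puts `z 0` below a member of the chain, hence inside `F (y
  -- 0)`, although it lies outside the larger `F (y (f 0))`.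
  · have hz : ∀ j, ∃ z, j < N + 2 → ¬ F (y (f j)) z ∧ F (y (f j + 1)) z := by
      intro j
      by_cases hj : j < N + 2
      · obtain ⟨z, hz⟩ := not_forall.1 (hf j hj).2
        refine ⟨z, fun _ => ?_⟩
        have : F (y (f j)) z → F (y (f j + 1)) z := hF (hlt _ (hf j hj).1).1.le le_rfl
        tauto
      · exact ⟨y 0, fun h => absurd h hj⟩
    choose z hz using hz
    have := hN (fun j => y (f j)) z fun i hi => ⟨(hz i (by omega)).1,
      hF (hle (hf' i (by omega)) (hf (i + 1) (by omega)).1.le) le_rfl (hz i (by omega)).2⟩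
    refine (hz 0 (by omega)).1 (hF (hle (Nat.zero_le _) (hf 0 (by omega)).1.le)
      (this.le.trans (hle (hf (N + 1) (by omega)).1.le le_rfl)) h0)

/-! ### Locating the end of a segment by counting classes. -/

/-- There are `n` distinct `r`-classes after that of `x`, up to and including that of `z`. -/
def ClassChain (r : M → M → Prop) : ℕ → M → M → Prop
  | 0, x, z => r x z
  | n + 1, x, z => ∃ w, ClassChain r n x w ∧ w < z ∧ ¬ r w z

/-- A chain that cannot be lengthened skips no class, so its classes are consecutive. -/
theorem ClassChain.succClassNat {r : M → M → Prop} {n : ℕ} {x z : M} (h : ClassChain r n x z)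
    (h' : ¬ ClassChain r (n + 1) x z) : SuccClassNat r n x z := by
  induction n generalizing z with
  | zero => exact h
  | succ n ih =>
    obtain ⟨w, hw, hwz, hr⟩ := h
    refine ⟨w, ih hw fun hw' => h' ⟨w, hw', hwz, hr⟩, hwz, hr, fun u hwu huz => ?_⟩
    by_contra hu
    rw [not_or] at hu
    exact h' ⟨u, ⟨w, hw, hwu, hu.1⟩, huz, hu.2⟩

theorem ClassChain.exists_seq {r : M → M → Prop} {n : ℕ} {x z : M} (h : ClassChain r n x z) :
    ∃ y : ℕ → M, r x (y 0) ∧ y n = z ∧ ∀ i < n, y i < y (i + 1) ∧ ¬ r (y i) (y (i + 1)) := by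
  induction n generalizing z with
  | zero => exact ⟨fun _ => z, h, rfl, by simp⟩
  | succ n ih =>
    obtain ⟨w, hw, hwz, hr⟩ := h
    obtain ⟨y, hy0, hyn, hy⟩ := ih hw
    refine ⟨fun i => if i ≤ n then y i else z, by simpa using hy0, by simp, fun i hi => ?_⟩
    rcases Nat.lt_succ_iff_lt_or_eq.1 hi with hi | rfl
    · simpa [hi.le, Nat.succ_le_of_lt hi] using hy i hi
    · simpa [hyn] using ⟨hwz, hr⟩

theorem nextClass_congr_of_lt {r : M → M → Prop} (hr : IsConvexEquiv r) {w w' z z' : M}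
    (hww : r w w') (h : NextClass r w z) (h' : NextClass r w' z') (hzz : z < z') : r z z' := by
  rcases lt_or_ge w' z with h₂ | h₂
  · exact (h'.2.2 z h₂ hzz).resolve_left fun h₃ => h.2.1 (hr.equivalence.trans hww h₃)
  · exact absurd ((hr.convex w).out (hr.equivalence.refl w) hww ⟨h.1.le, h₂⟩) h.2.1

theorem succClassNat_congr {r : M → M → Prop} (hr : IsConvexEquiv r) {n : ℕ} {x z z' : M}
    (hz : SuccClassNat r n x z) (hz' : SuccClassNat r n x z') : r z z' := by
  induction n generalizing z z' with
  | zero => exact hr.equivalence.trans (hr.equivalence.symm hz) hz'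
  | succ n ih =>
    obtain ⟨w, hw, hwz⟩ := hz
    obtain ⟨w', hw', hwz'⟩ := hz'
    have hww := ih hw hw'
    rcases lt_trichotomy z z' with h | rfl | h
    · exact nextClass_congr_of_lt hr hww hwz hwz' h
    · exact hr.equivalence.refl _
    · exact hr.equivalence.symm (nextClass_congr_of_lt hr (hr.equivalence.symm hww) hwz' hwz h)

theorem succClassNat_trans_rel {r : M → M → Prop} (hr : IsConvexEquiv r) {n : ℕ} {x z z' : M}
    (hz : SuccClassNat r n x z) (hzz : r z z') : SuccClassNat r n x z' := by
  cases n with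
  | zero => exact hr.equivalence.trans hz hzz
  | succ n =>
    obtain ⟨w, hw, hwz, hrw, hn⟩ := hz
    have hrw' : ¬ r w z' := fun h => hrw (hr.equivalence.trans h (hr.equivalence.symm hzz))
    refine ⟨w, hw, lt_of_not_ge fun hle => hrw' ?_, hrw', fun u hu hu' => ?_⟩
    · exact hr.equivalence.symm
        ((hr.convex z').out (hr.equivalence.refl z') (hr.equivalence.symm hzz) ⟨hle, hwz.le⟩)
    · rcases lt_or_ge u z with h | h
      · exact (hn u hu h).imp_right fun h => hr.equivalence.trans h hzz
      · exact Or.inr (hr.equivalence.trans (hr.equivalence.symm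
          ((hr.convex z).out (hr.equivalence.refl z) hzz ⟨h, hu'.le⟩)) hzz)

/-- The class of `z` is the last class of `kernelRel F` contained in the segment `F x`, and it is
the `n`-th successor of the class of `x`. -/
def LastClass (F : M → M → Prop) (n : ℕ) (x z : M) : Prop :=
  SuccClassNat (kernelRel F) n x z ∧ F x z ∧ ∀ w, F x w → z < w → kernelRel F z w

theorem exists_lastClass {F : M → M → Prop} (hF : IsMonotoneRel F) (hrefl : ∀ x, F x x) {N : ℕ}
    (hN : ∀ x z, Interlaced F N x z → z 0 < x (N + 1)) (x : M) :
    ∃ n < 2 * (N + 2), ∃ z, LastClass F n x z := by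
  classical
  set p : ℕ → Prop := fun n => ∃ z, F x z ∧ ClassChain (kernelRel F) n x z with hp
  have hbound : ¬ p (2 * (N + 2)) := by
    rintro ⟨z, hxz, hz⟩
    obtain ⟨y, hy0, rfl, hy⟩ := hz.exists_seq
    exact kernelRel_chain_bounded hF hN y hy ((hy0.1 _).1 hxz)
  have hp0 : p 0 := ⟨x, hrefl x, (isConvexEquiv_kernelRel hF).equivalence.refl x⟩
  -- `m` is the least impossible chain length, so `m - 1` is attained and the chain attaining it
  -- reaches the last class.
  set m := Nat.find (⟨_, hbound⟩ : ∃ n, ¬ p n) with hm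
  have hpm : ¬ p m := Nat.find_spec (⟨_, hbound⟩ : ∃ n, ¬ p n)
  have hm0 : m ≠ 0 := fun h => hpm (h ▸ hp0)
  have hlast : p (m - 1) :=
    not_not.1 (Nat.find_min (⟨_, hbound⟩ : ∃ n, ¬ p n) (show m - 1 < m by omega))
  have hm1 : m - 1 + 1 = m := by omega
  obtain ⟨z, hxz, hz⟩ := hlast
  refine ⟨m - 1, ?_, z, hz.succClassNat fun h => hpm ⟨z, hxz, hm1 ▸ h⟩, hxz, fun w hw hzw => ?_⟩
  · have : m ≤ 2 * (N + 2) := Nat.find_min' _ hbound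
    omega
  · by_contra hr
    exact hpm ⟨w, hw, hm1 ▸ ⟨z, hz, hzw, hr⟩⟩

theorem LastClass.iff_leSucc {F : M → M → Prop} (hF : IsMonotoneRel F) {n : ℕ} {x z : M}
    (h : LastClass F n x z) (y : M) : F x y ↔ LeSucc (kernelRel F) n y x := by
  have hr := isConvexEquiv_kernelRel hF
  have hS : ∀ u, SuccClass (kernelRel F) n x u ↔ SuccClassNat (kernelRel F) n x u := fun u => by
    simp [SuccClass]
  simp only [LeSucc, LtSucc, hS]
  constructor
  · intro hy
    by_cases hzy : kernelRel F z y
    · exact Or.inr (succClassNat_trans_rel hr h.1 hzy)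
    · have hyz : y < z := by
        rcases lt_trichotomy y z with h' | rfl | h'
        · exact h'
        · exact absurd (hr.equivalence.refl y) hzy
        · exact absurd (h.2.2 y hy h') hzy
      refine Or.inl ⟨⟨z, h.1⟩, fun u hu => lt_of_not_ge fun hle => hzy ?_⟩
      have hzu := succClassNat_congr hr h.1 hu
      exact (hr.convex z).out hzu (hr.equivalence.refl z) ⟨hle, hyz.le⟩
  · rintro (⟨-, hy⟩ | hy)
    · exact hF le_rfl (hy z h.1).le h.2.1
    · exact ((succClassNat_congr hr h.1 hy).2 x).1 h.2.1

/-- If `x (N + 2) ≤ z 0`, the disjunct `z ≤ x` never holds along the sequence, so the sequence is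
interlaced for `A` itself. The extra step gives the strict inequality `x (i + 1) < x (N + 2)` for
all `i ≤ N`. -/
theorem interlaced_le_or_bounded {A : M → M → Prop} (hA : IsMonotoneRel A) {N : ℕ}
    (hN : ∀ x z, Interlaced A N x z → z 0 < x (N + 1)) (x z : ℕ → M)
    (h : Interlaced (fun x z => z ≤ x ∨ A x z) (N + 1) x z) : z 0 < x (N + 2) := by
  have hF : IsMonotoneRel fun x z => z ≤ x ∨ A x z := fun _ _ _ _ hx hz h =>
    h.imp (fun h => hz.trans (h.trans hx)) (hA hx hz)
  by_contra! hle
  refine absurd (hN x z fun i hi => ⟨fun h' => (h i (by omega)).1 (Or.inr h'),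
    (h i (by omega)).2.resolve_left fun h' => ?_⟩) (not_lt.2
      ((h.left_le hF (by omega) (by omega)).trans hle))
  have h₁ := h.right_le hF (Nat.zero_le i) (by omega)
  have h₂ := h.lt_succ hF (show i + 1 ≤ N + 1 by omega)
  have h₃ := h.left_le hF (show i + 1 + 1 ≤ N + 2 by omega) (by omega)
  exact absurd (h'.trans_lt (h₂.trans_le (h₃.trans hle))) (not_lt.2 h₁)

end Order

/-! ### Closure properties of definable and of quantifier-free definable predicates. -/

section Definability

variable (L : Language) {M : Type*} [L.Structure M] {ι κ : Type}

/-- The predicate `q` on tuples is defined by a formula without parameters. -/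
def IsDef (q : (ι → M) → Prop) : Prop :=
  ∃ φ : L.Formula ι, ∀ v, φ.Realize v ↔ q v

/-- The predicate `q` on tuples is defined by a quantifier-free formula. -/
def IsQFDef (q : (ι → M) → Prop) : Prop :=
  ∃ φ : L.Formula ι, φ.IsQF ∧ ∀ v, φ.Realize v ↔ q v

/-- The unary predicate `P` is defined by a formula without parameters. -/
def IsDef₁ (P : M → Prop) : Prop := IsDef L fun v : Fin 1 → M => P (v 0)

/-- The binary relation `A` is defined by a formula without parameters. -/
def IsDef₂ (A : M → M → Prop) : Prop := IsDef L fun v : Fin 2 → M => A (v 0) (v 1)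

variable {L}

theorem IsDef.not {q : (ι → M) → Prop} (h : IsDef L q) : IsDef L fun v => ¬ q v := by
  obtain ⟨φ, hφ⟩ := h
  exact ⟨φ.not, fun v => by rw [Language.Formula.realize_not, hφ]⟩

theorem IsDef.imp {q r : (ι → M) → Prop} (h : IsDef L q) (h' : IsDef L r) :
    IsDef L fun v => q v → r v := by
  obtain ⟨φ, hφ⟩ := h
  obtain ⟨ψ, hψ⟩ := h'
  exact ⟨φ.imp ψ, fun v => by rw [Language.Formula.realize_imp, hφ, hψ]⟩

theorem IsDef.and {q r : (ι → M) → Prop} (h : IsDef L q) (h' : IsDef L r) :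
    IsDef L fun v => q v ∧ r v := by
  obtain ⟨φ, hφ⟩ := h
  obtain ⟨ψ, hψ⟩ := h'
  exact ⟨φ ⊓ ψ, fun v => by rw [Language.Formula.realize_inf, hφ, hψ]⟩

theorem IsDef.or {q r : (ι → M) → Prop} (h : IsDef L q) (h' : IsDef L r) :
    IsDef L fun v => q v ∨ r v := by
  obtain ⟨φ, hφ⟩ := h
  obtain ⟨ψ, hψ⟩ := h'
  exact ⟨φ ⊔ ψ, fun v => by rw [Language.Formula.realize_sup, hφ, hψ]⟩

theorem IsDef.iff {q r : (ι → M) → Prop} (h : IsDef L q) (h' : IsDef L r) :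
    IsDef L fun v => q v ↔ r v := by
  simpa only [iff_iff_implies_and_implies] using (h.imp h').and (h'.imp h)

theorem IsDef.reindex {q : (ι → M) → Prop} (h : IsDef L q) (f : ι → κ) :
    IsDef L fun v : κ → M => q fun i => v (f i) := by
  obtain ⟨φ, hφ⟩ := h
  exact ⟨φ.relabel f, fun v => by rw [Language.Formula.realize_relabel, hφ]; rfl⟩

theorem IsDef.ex {q : (ι → M) → M → Prop}
    (h : IsDef L fun v : Option ι → M => q (fun i => v (some i)) (v none)) :
    IsDef L fun v => ∃ z, q v z := by
  obtain ⟨φ, hφ⟩ := h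
  refine ⟨(φ.relabel fun o : Option ι => o.elim (Sum.inr ()) Sum.inl).iExs Unit, fun v => ?_⟩
  rw [Language.Formula.realize_iExs]
  simp only [Language.Formula.realize_relabel, hφ]
  exact ⟨fun ⟨i, hi⟩ => ⟨i (), hi⟩, fun ⟨z, hz⟩ => ⟨fun _ => z, hz⟩⟩

theorem IsDef.all {q : (ι → M) → M → Prop}
    (h : IsDef L fun v : Option ι → M => q (fun i => v (some i)) (v none)) :
    IsDef L fun v => ∀ z, q v z := by
  simpa using (IsDef.ex (q := fun v z => ¬ q v z) h.not).not

theorem IsDef₁.app {P : M → Prop} (h : IsDef₁ L P) (i : ι) : IsDef L fun v : ι → M => P (v i) :=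
  IsDef.reindex h fun _ => i

theorem IsDef₂.app {A : M → M → Prop} (h : IsDef₂ L A) (i j : ι) :
    IsDef L fun v : ι → M => A (v i) (v j) :=
  IsDef.reindex h ![i, j]

theorem IsDef₂.diag {A : M → M → Prop} (h : IsDef₂ L A) : IsDef₁ L fun x => A x x :=
  h.app 0 0

theorem IsDef₂.dual {A : M → M → Prop} (h : IsDef₂ L A) : IsDef₂ L fun x z => ¬ A z x :=
  (h.app 1 0).not

theorem isDef₁_const (p : Prop) : IsDef₁ L fun _ : M => p := by
  by_cases hp : p
  · exact ⟨⊤, fun v => by simp [hp]⟩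
  · exact ⟨⊥, fun v => by simp [hp]⟩

theorem IsDef₁.and {P Q : M → Prop} (h : IsDef₁ L P) (h' : IsDef₁ L Q) :
    IsDef₁ L fun x => P x ∧ Q x :=
  IsDef.and h h'

theorem IsDef₁.not {P : M → Prop} (h : IsDef₁ L P) : IsDef₁ L fun x => ¬ P x :=
  IsDef.not h

theorem isDef₂_const (p : Prop) : IsDef₂ L fun _ _ : M => p :=
  (isDef₁_const p).app (0 : Fin 2)

theorem isDef₂_rel (R : L.Relations 2) :
    IsDef₂ L fun x y : M => Language.Structure.RelMap R ![x, y] :=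
  ⟨R.formula₂ (Language.Term.var 0) (Language.Term.var 1), fun v => by
    rw [Language.Formula.realize_rel₂]; rfl⟩

theorem isDef₁_rel (R : L.Relations 1) :
    IsDef₁ L fun x : M => Language.Structure.RelMap R ![x] :=
  ⟨R.formula₁ (Language.Term.var 0), fun v => by
    rw [Language.Formula.realize_rel₁]; rfl⟩

theorem IsDef₁.definable₁ {P : M → Prop} (h : IsDef₁ L P) :
    (∅ : Set M).Definable₁ L {x | P x} := by
  obtain ⟨φ, hφ⟩ := h
  exact Set.empty_definable_iff.2 ⟨φ, Set.ext fun v => (hφ v).symm⟩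

theorem IsDef₂.definable₂ {A : M → M → Prop} (h : IsDef₂ L A) :
    (∅ : Set M).Definable₂ L {p : M × M | A p.1 p.2} := by
  obtain ⟨φ, hφ⟩ := h
  exact Set.empty_definable_iff.2 ⟨φ, Set.ext fun v => (hφ v).symm⟩

theorem IsDef₂.separated {P : M → Prop} {A B : M → M → Prop} (hP : IsDef₁ L P) (hA : IsDef₂ L A)
    (hB : IsDef₂ L B) : IsDef₂ L (Separated P A B) :=
  IsDef.not (IsDef.ex ((hP.app _).and ((hB.app _ _).and (hA.app _ _).not)))

theorem IsDef₂.kernelRel {F : M → M → Prop} (hF : IsDef₂ L F) : IsDef₂ L (kernelRel F) :=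
  IsDef.and (IsDef.all ((hF.app _ _).iff (hF.app _ _)))
    (IsDef.all ((hF.app _ _).iff (hF.app _ _)))

section Order

variable [LinearOrder M]

theorem isDef₂_nextClass (hlt : IsDef₂ L fun x y : M => x < y) {r : M → M → Prop}
    (hr : IsDef₂ L r) : IsDef₂ L (NextClass r) :=
  (hlt.app 0 1).and ((hr.app 0 1).not.and (IsDef.all ((hlt.app _ _).imp
    ((hlt.app _ _).imp ((hr.app _ _).or (hr.app _ _))))))

theorem isDef₂_succClassNat (hlt : IsDef₂ L fun x y : M => x < y) {r : M → M → Prop}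
    (hr : IsDef₂ L r) (n : ℕ) : IsDef₂ L (SuccClassNat r n) := by
  induction n with
  | zero => exact hr
  | succ n ih => exact IsDef.ex ((ih.app _ _).and ((isDef₂_nextClass hlt hr).app _ _))

theorem isDef₁_lastClass (hlt : IsDef₂ L fun x y : M => x < y) {F : M → M → Prop}
    (hF : IsDef₂ L F) (n : ℕ) : IsDef₁ L fun x => ∃ z, LastClass F n x z :=
  IsDef.ex (((isDef₂_succClassNat hlt hF.kernelRel n).app _ _).and ((hF.app _ _).and
    (IsDef.all ((hF.app _ _).imp ((hlt.app _ _).imp (hF.kernelRel.app _ _))))))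

end Order

theorem IsQFDef.not {q : (ι → M) → Prop} (h : IsQFDef L q) : IsQFDef L fun v => ¬ q v := by
  obtain ⟨φ, hφ', hφ⟩ := h
  exact ⟨φ.not, hφ'.not, fun v => by rw [Language.Formula.realize_not, hφ]⟩

theorem IsQFDef.imp {q r : (ι → M) → Prop} (h : IsQFDef L q) (h' : IsQFDef L r) :
    IsQFDef L fun v => q v → r v := by
  obtain ⟨φ, hφ', hφ⟩ := h
  obtain ⟨ψ, hψ', hψ⟩ := h'
  exact ⟨φ.imp ψ, hφ'.imp hψ', fun v => by rw [Language.Formula.realize_imp, hφ, hψ]⟩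

theorem IsQFDef.and {q r : (ι → M) → Prop} (h : IsQFDef L q) (h' : IsQFDef L r) :
    IsQFDef L fun v => q v ∧ r v := by
  obtain ⟨φ, hφ', hφ⟩ := h
  obtain ⟨ψ, hψ', hψ⟩ := h'
  exact ⟨φ ⊓ ψ, hφ'.inf hψ', fun v => by rw [Language.Formula.realize_inf, hφ, hψ]⟩

theorem IsQFDef.or {q r : (ι → M) → Prop} (h : IsQFDef L q) (h' : IsQFDef L r) :
    IsQFDef L fun v => q v ∨ r v := by
  obtain ⟨φ, hφ', hφ⟩ := h
  obtain ⟨ψ, hψ', hψ⟩ := h'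
  exact ⟨φ ⊔ ψ, hφ'.sup hψ', fun v => by rw [Language.Formula.realize_sup, hφ, hψ]⟩

theorem isQFDef_false : IsQFDef L fun _ : ι → M => False :=
  ⟨⊥, Language.BoundedFormula.isQF_bot, fun _ => Iff.rfl⟩

theorem IsQFDef.exists_lt {q : ℕ → (ι → M) → Prop} (h : ∀ n, IsQFDef L (q n)) (m : ℕ) :
    IsQFDef L fun v => ∃ n < m, q n v := by
  induction m with
  | zero => simpa using isQFDef_false
  | succ m ih =>
    convert ih.or (h m) using 2
    rw [Nat.exists_lt_succ_right]

theorem isQFDef_rel₂ (R : L.Relations 2) (i j : ι) :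
    IsQFDef L fun v : ι → M => Language.Structure.RelMap R ![v i, v j] :=
  ⟨R.formula₂ (Language.Term.var i) (Language.Term.var j),
    (Language.BoundedFormula.IsAtomic.rel _ _).isQF, fun v => by
    rw [Language.Formula.realize_rel₂]; rfl⟩

theorem isQFDef_rel₁ (R : L.Relations 1) (i : ι) :
    IsQFDef L fun v : ι → M => Language.Structure.RelMap R ![v i] :=
  ⟨R.formula₁ (Language.Term.var i),
    (Language.BoundedFormula.IsAtomic.rel _ _).isQF, fun v => by
    rw [Language.Formula.realize_rel₁]; rfl⟩

/-- Equivalence in a structure is equivalence modulo its complete theory. -/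
theorem completeTheory_iff_of_realize_iff {n : ℕ} {φ ψ : L.Formula (Fin n)}
    (h : ∀ v : Fin n → M, φ.Realize v ↔ ψ.Realize v) : (L.completeTheory M).Iff φ ψ := by
  have hM : M ⊨ (((φ.iff ψ).relabel (Sum.inr : Fin n → Empty ⊕ Fin n)).iAlls (Fin n) :
      L.Sentence) := by
    rw [Language.Sentence.Realize, Language.Formula.realize_iAlls]
    intro v
    rw [Language.Formula.realize_relabel, Language.Formula.realize_iff]
    exact h _
  intro N v xs
  have hN := (Language.realize_iff_of_model_completeTheory M N _).2 hM
  rw [Language.Sentence.Realize, Language.Formula.realize_iAlls] at hN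
  have := hN v
  rw [Language.Formula.realize_relabel] at this
  rwa [Subsingleton.elim xs default]

end Definability

/-! ### Quantifier elimination down to Boolean combinations of good relations. -/

section BooleanCombinations

variable (L : Language) {M : Type*} [L.Structure M] [LinearOrder M] {ι κ : Type}

/-- Definable monotone local relations. -/
structure IsGood (A : M → M → Prop) : Prop where
  isDef : IsDef₂ L A
  mono : IsMonotoneRel A
  isLocal : IsLocalRel A

/-- Boolean combinations of definable unary predicates and definable monotone local relations,
applied to coordinates. -/
inductive BoolComb : ((ι → M) → Prop) → Prop
  | unary {P : M → Prop} (hP : IsDef₁ L P) (i : ι) : BoolComb fun v => P (v i)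
  | rel {A : M → M → Prop} (hA : IsGood L A) (i j : ι) : BoolComb fun v => A (v i) (v j)
  | false : BoolComb fun _ => False
  | imp {q r : (ι → M) → Prop} (hq : BoolComb q) (hr : BoolComb r) : BoolComb fun v => q v → r v

/-- Conjunctions of a Boolean combination in the variables `v` with conditions saying that `z`
belongs to a definable set and lies inside or outside given segments. -/
inductive Cell : ((ι → M) → M → Prop) → Prop
  | param {q : (ι → M) → Prop} (hq : BoolComb L q) : Cell fun v _ => q v
  | unary {P : M → Prop} (hP : IsDef₁ L P) : Cell fun _ z => P z
  | upper {A : M → M → Prop} (hA : IsGood L A) (i : ι) : Cell fun v z => A (v i) z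
  | lower {A : M → M → Prop} (hA : IsGood L A) (i : ι) : Cell fun v z => ¬ A (v i) z
  | and {q r : (ι → M) → M → Prop} (hq : Cell q) (hr : Cell r) : Cell fun v z => q v z ∧ r v z

/-- Finite disjunctions of cells. -/
inductive CellUnion : ((ι → M) → M → Prop) → Prop
  | cell {q : (ι → M) → M → Prop} (hq : Cell L q) : CellUnion q
  | or {q r : (ι → M) → M → Prop} (hq : CellUnion q) (hr : CellUnion r) :
      CellUnion fun v z => q v z ∨ r v z

variable {L}

theorem IsGood.dual {A : M → M → Prop} (hA : IsGood L A) : IsGood L fun x z => ¬ A z x :=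
  ⟨hA.isDef.dual, hA.mono.dual, hA.isLocal.dual hA.mono⟩

theorem IsGood.separated {P : M → Prop} {A B : M → M → Prop} (hP : IsDef₁ L P) (hA : IsGood L A)
    (hB : IsGood L B) : IsGood L (Separated P A B) :=
  ⟨IsDef₂.separated hP hA.isDef hB.isDef, hA.mono.separated hB.mono,
    IsLocalRel.separated hA.mono hB.mono hA.isLocal hB.isLocal⟩

theorem isGood_const (p : Prop) : IsGood L fun _ _ : M => p :=
  ⟨isDef₂_const p, fun _ _ _ _ _ _ h => h, 0, fun _ _ h => absurd (h 0 le_rfl).2 (h 0 le_rfl).1⟩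

namespace BoolComb

theorem congr {q r : (ι → M) → Prop} (hq : BoolComb L q) (h : ∀ v, q v ↔ r v) : BoolComb L r :=
  (funext fun v => propext (h v)) ▸ hq

theorem not {q : (ι → M) → Prop} (hq : BoolComb L q) : BoolComb L fun v => ¬ q v :=
  hq.imp false

theorem const (p : Prop) : BoolComb L fun _ : ι → M => p := by
  by_cases hp : p
  · exact false.not.congr fun _ => by simp [hp]
  · exact false.congr fun _ => by simp [hp]

theorem and {q r : (ι → M) → Prop} (hq : BoolComb L q) (hr : BoolComb L r) :
    BoolComb L fun v => q v ∧ r v :=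
  (hq.imp hr.not).not.congr fun _ => by tauto

theorem or {q r : (ι → M) → Prop} (hq : BoolComb L q) (hr : BoolComb L r) :
    BoolComb L fun v => q v ∨ r v :=
  (hq.not.imp hr).congr fun _ => by tauto

theorem forall_mem {α : Type*} (l : List α) {q : α → (ι → M) → Prop}
    (h : ∀ a, BoolComb L (q a)) : BoolComb L fun v => ∀ a ∈ l, q a v := by
  induction l with
  | nil => exact (const True).congr fun _ => by simp
  | cons a l ih => exact ((h a).and ih).congr fun _ => by simp

theorem reindex {q : (ι → M) → Prop} (h : BoolComb L q) (f : ι → κ) :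
    BoolComb L fun v : κ → M => q fun i => v (f i) := by
  induction h with
  | unary hP i => exact unary hP (f i)
  | rel hA i j => exact rel hA (f i) (f j)
  | false => exact false
  | imp _ _ hq hr => exact hq.imp hr

end BoolComb

theorem CellUnion.congr {q r : (ι → M) → M → Prop} (hq : CellUnion L q)
    (h : ∀ v z, q v z ↔ r v z) : CellUnion L r :=
  (funext fun v => funext fun z => propext (h v z)) ▸ hq

theorem CellUnion.and {q r : (ι → M) → M → Prop} (hq : CellUnion L q) (hr : CellUnion L r) :
    CellUnion L fun v z => q v z ∧ r v z := by
  induction hq with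
  | cell hq =>
    induction hr with
    | cell hr => exact .cell (hq.and hr)
    | or _ _ h₁ h₂ => exact (h₁.or h₂).congr fun _ _ => by tauto
  | or _ _ h₁ h₂ => exact (h₁.or h₂).congr fun _ _ => by tauto

theorem Cell.not {q : (ι → M) → M → Prop} (hq : Cell L q) : CellUnion L fun v z => ¬ q v z := by
  induction hq with
  | param hq => exact .cell (.param hq.not)
  | unary hP => exact .cell (.unary hP.not)
  | upper hA i => exact .cell (.lower hA i)
  | lower hA i => exact (CellUnion.cell (.upper hA i)).congr fun _ _ => not_not.symm
  | and _ _ h₁ h₂ => exact (h₁.or h₂).congr fun _ _ => by tauto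

theorem CellUnion.not {q : (ι → M) → M → Prop} (hq : CellUnion L q) :
    CellUnion L fun v z => ¬ q v z := by
  induction hq with
  | cell hq => exact hq.not
  | or _ _ h₁ h₂ => exact (h₁.and h₂).congr fun _ _ => by tauto

theorem BoolComb.cellUnion {q : (Option ι → M) → Prop} (hq : BoolComb L q) :
    CellUnion L fun (v : ι → M) z => q fun o => o.elim z v := by
  induction hq with
  | unary hP i =>
    cases i with
    | none => exact .cell (.unary hP)
    | some i => exact .cell (.param (.unary hP i))
  | rel hA i j =>
    cases i with
    | none =>
      cases j with
      | none => exact .cell (.unary hA.isDef.diag)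
      | some j =>
        -- With `z` in the first argument the condition cuts out a final segment, the complement of
        -- a dual segment.
        exact (CellUnion.cell (.lower hA.dual j)).congr fun _ _ => not_not
    | some i =>
      cases j with
      | none => exact .cell (.upper hA i)
      | some j => exact .cell (.param (.rel hA i j))
  | false => exact .cell (.param .false)
  | imp _ _ hq hr => exact (hq.not.or hr).congr fun _ _ => by tauto

theorem Cell.exists_normalForm {Q : (ι → M) → M → Prop} (hQ : Cell L Q) :
    ∃ (q : (ι → M) → Prop) (P : M → Prop) (U W : List ({A : M → M → Prop // IsGood L A} × ι)),
      BoolComb L q ∧ IsDef₁ L P ∧ ∀ v z, Q v z ↔ q v ∧ P z ∧ (∀ u ∈ U, u.1.1 (v u.2) z) ∧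
        ∀ w ∈ W, ¬ w.1.1 (v w.2) z := by
  induction hQ with
  | param hq => exact ⟨_, fun _ => True, [], [], hq, isDef₁_const True, by simp⟩
  | unary hP => exact ⟨fun _ => True, _, [], [], .const True, hP, by simp⟩
  | upper hA i =>
    exact ⟨fun _ => True, fun _ => True, [(⟨_, hA⟩, i)], [], .const True, isDef₁_const True,
      by simp⟩
  | lower hA i =>
    exact ⟨fun _ => True, fun _ => True, [], [(⟨_, hA⟩, i)], .const True, isDef₁_const True,
      by simp⟩
  | and _ _ h₁ h₂ =>
    obtain ⟨q₁, P₁, U₁, W₁, hq₁, hP₁, h₁⟩ := h₁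
    obtain ⟨q₂, P₂, U₂, W₂, hq₂, hP₂, h₂⟩ := h₂
    refine ⟨_, _, U₁ ++ U₂, W₁ ++ W₂, hq₁.and hq₂, hP₁.and hP₂, fun v z => ?_⟩
    simp only [h₁, h₂, List.mem_append, or_imp, forall_and]
    tauto

theorem exists_least_segment {α : Type*} {S : α → M → Prop}
    (hS : ∀ a ⦃z z'⦄, z' ≤ z → S a z → S a z') (l : List α) (hl : l ≠ []) :
    ∃ a ∈ l, ∀ b ∈ l, ∀ z, S a z → S b z := by
  induction l with
  | nil => exact absurd rfl hl
  | cons b l ih =>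
    rcases eq_or_ne l [] with rfl | hl'
    · exact ⟨b, by simp, by simp⟩
    obtain ⟨a, hal, ha⟩ := ih hl'
    by_cases hab : ∀ z, S a z → S b z
    · refine ⟨a, by simp [hal], fun c hc => ?_⟩
      rcases List.mem_cons.1 hc with rfl | hc
      · exact hab
      · exact ha c hc
    · push Not at hab
      obtain ⟨z, haz, hbz⟩ := hab
      refine ⟨b, by simp, fun c hc w hw => ?_⟩
      rcases List.mem_cons.1 hc with rfl | hc
      · exact hw
      · exact ha c hc w (hS a (le_of_not_ge fun h => hbz (hS b h hw)) haz)

/-- Complements of initial segments are initial segments of the reversed order. -/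
theorem exists_greatest_segment {α : Type*} {S : α → M → Prop}
    (hS : ∀ a ⦃z z'⦄, z' ≤ z → S a z → S a z') (l : List α) (hl : l ≠ []) :
    ∃ a ∈ l, ∀ b ∈ l, ∀ z, S b z → S a z := by
  obtain ⟨a, ha, h⟩ := exists_least_segment (M := Mᵒᵈ)
    (S := fun a z => ¬ S a (OrderDual.ofDual z)) (fun a z z' hz h h' => h (hS a hz h')) l hl
  exact ⟨a, ha, fun b hb z hz => by_contra fun hz' => h b hb (OrderDual.toDual z) hz' hz⟩

theorem Cell.ex {Q : (ι → M) → M → Prop} (hQ : Cell L Q) : BoolComb L fun v => ∃ z, Q v z := by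
  rcases isEmpty_or_nonempty ι with hι | ⟨⟨i₀⟩⟩
  · exact (BoolComb.const (∃ z, Q isEmptyElim z)).congr fun v => by
      rw [Subsingleton.elim v isEmptyElim]
  obtain ⟨q, P, U, W, hq, hP, h⟩ := hQ.exists_normalForm
  -- The trivial segments (everything and nothing) make both lists nonempty; they need an index
  -- `i₀`, hence the separate case of empty `ι`.
  let U' := ((⟨_, isGood_const True⟩, i₀) : {A : M → M → Prop // IsGood L A} × ι) :: U
  let W' := ((⟨_, isGood_const False⟩, i₀) : {A : M → M → Prop // IsGood L A} × ι) :: W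
  have h' : ∀ v z, Q v z ↔ q v ∧ P z ∧ (∀ u ∈ U', u.1.1 (v u.2) z) ∧
      ∀ w ∈ W', ¬ w.1.1 (v w.2) z := fun v z => by simp [h, U', W']
  have hlow : ∀ (v : ι → M) (a : {A : M → M → Prop // IsGood L A} × ι) ⦃z z' : M⦄, z' ≤ z →
      a.1.1 (v a.2) z → a.1.1 (v a.2) z' := fun v a z z' hz => a.1.2.mono le_rfl hz
  refine (hq.and (BoolComb.forall_mem U' fun u => BoolComb.forall_mem W' fun w =>
    (BoolComb.rel (IsGood.separated hP w.1.2 u.1.2) w.2 u.2).not)).congr fun v => ?_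
  simp only [h', Separated, not_not]
  constructor
  · rintro ⟨hqv, hall⟩
    obtain ⟨u, hu, hu'⟩ := exists_least_segment (hlow v) U' (List.cons_ne_nil _ _)
    obtain ⟨w, hw, hw'⟩ := exists_greatest_segment (hlow v) W' (List.cons_ne_nil _ _)
    obtain ⟨z, hPz, huz, hwz⟩ := hall u hu w hw
    exact ⟨z, hqv, hPz, fun b hb => hu' b hb z huz, fun b hb hbz => hwz (hw' b hb z hbz)⟩
  · rintro ⟨z, hqv, hPz, hu, hw⟩
    exact ⟨hqv, fun u hu' w hw' => ⟨z, hPz, hu u hu', hw w hw'⟩⟩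

theorem CellUnion.ex {Q : (ι → M) → M → Prop} (hQ : CellUnion L Q) :
    BoolComb L fun v => ∃ z, Q v z := by
  induction hQ with
  | cell hq => exact hq.ex
  | or _ _ h₁ h₂ => exact (h₁.or h₂).congr fun _ => exists_or.symm

theorem BoolComb.ex {Q : (ι → M) → M → Prop}
    (h : BoolComb L fun v : Option ι → M => Q (fun i => v (some i)) (v none)) :
    BoolComb L fun v => ∃ z, Q v z :=
  h.cellUnion.ex

theorem BoolComb.all {Q : (ι → M) → M → Prop}
    (h : BoolComb L fun v : Option ι → M => Q (fun i => v (some i)) (v none)) :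
    BoolComb L fun v => ∀ z, Q v z :=
  (BoolComb.ex (Q := fun v z => ¬ Q v z) h.not).not.congr fun v => by simp

theorem BoolComb.succClassNat {r : M → M → Prop} (hlt : ∀ {κ : Type} (i j : κ),
      BoolComb L fun v : κ → M => v i < v j)
    (hr : ∀ {κ : Type} (i j : κ), BoolComb L fun v : κ → M => r (v i) (v j)) (n : ℕ) (i j : ι) :
    BoolComb L fun v : ι → M => SuccClassNat r n (v i) (v j) := by
  induction n generalizing ι with
  | zero => exact hr i j
  | succ n ih =>
    exact BoolComb.ex ((ih _ _).and ((hlt _ _).and ((hr _ _).not.and (BoolComb.all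
      ((hlt _ _).imp ((hlt _ _).imp ((hr _ _).or (hr _ _))))))))

theorem BoolComb.succClass {r : M → M → Prop} (hlt : ∀ {κ : Type} (i j : κ),
      BoolComb L fun v : κ → M => v i < v j)
    (hr : ∀ {κ : Type} (i j : κ), BoolComb L fun v : κ → M => r (v i) (v j)) (n : ℤ) (i j : ι) :
    BoolComb L fun v : ι → M => SuccClass r n (v i) (v j) := by
  unfold SuccClass
  split
  · exact succClassNat hlt hr _ i j
  · exact succClassNat hlt hr _ j i

theorem BoolComb.ltSucc {r : M → M → Prop} (hlt : ∀ {κ : Type} (i j : κ),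
      BoolComb L fun v : κ → M => v i < v j)
    (hr : ∀ {κ : Type} (i j : κ), BoolComb L fun v : κ → M => r (v i) (v j)) (n : ℤ) (i j : ι) :
    BoolComb L fun v : ι → M => LtSucc r n (v i) (v j) :=
  (BoolComb.ex (succClass hlt hr n _ _)).and
    (BoolComb.all ((succClass hlt hr n _ _).imp (hlt _ _)))

end BooleanCombinations

/-! ### Back to the named structure: good relations become quantifier-free. -/

section Named

variable {I J M : Type*} [LinearOrder M] [(ccelSuccLanguage I J).Structure M] {ι : Type}

theorem isDef₂_lt (hM : IsNamedCcelSucc I J M) :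
    IsDef₂ (ccelSuccLanguage I J) fun x y : M => x < y := by
  have := isDef₂_rel (L := ccelSuccLanguage I J) (M := M) CcelSuccRel.lt
  simpa only [← ltInterp.eq_def, hM.lt_iff] using this

theorem isDef₂_le (hM : IsNamedCcelSucc I J M) :
    IsDef₂ (ccelSuccLanguage I J) fun x z : M => z ≤ x := by
  have := IsDef.not (isDef₂_lt hM)
  simp only [not_lt] at this
  exact this

theorem isGood_le (hM : IsNamedCcelSucc I J M) :
    IsGood (ccelSuccLanguage I J) fun x z : M => z ≤ x :=
  ⟨isDef₂_le hM, fun _ _ _ _ hx hz h => hz.trans (h.trans hx), isLocalRel_le⟩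

theorem isGood_le_or_EInterp (hM : IsNamedCcelSucc I J M) (j : J) :
    IsGood (ccelSuccLanguage I J) fun x z : M => z ≤ x ∨ EInterp I M j x z :=
  ⟨IsDef.or (isDef₂_le hM) (isDef₂_rel (L := ccelSuccLanguage I J) (CcelSuccRel.E j)),
    isMonotoneRel_of_convexEquiv (hM.isConvexEquiv j),
    isLocalRel_of_convexEquiv (hM.isConvexEquiv j)⟩

theorem boolComb_lt (hM : IsNamedCcelSucc I J M) (i j : ι) :
    BoolComb (ccelSuccLanguage I J) fun v : ι → M => v i < v j :=
  (BoolComb.rel (isGood_le hM) i j).not.congr fun _ => not_le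

theorem boolComb_eq (hM : IsNamedCcelSucc I J M) (i j : ι) :
    BoolComb (ccelSuccLanguage I J) fun v : ι → M => v i = v j :=
  ((BoolComb.rel (isGood_le hM) i j).and (BoolComb.rel (isGood_le hM) j i)).congr fun _ => by
    rw [le_antisymm_iff, and_comm]

theorem boolComb_EInterp (hM : IsNamedCcelSucc I J M) (k : J) (i j : ι) :
    BoolComb (ccelSuccLanguage I J) fun v : ι → M => EInterp I M k (v i) (v j) := by
  have hr := (hM.isConvexEquiv k).equivalence
  refine ((BoolComb.rel (isGood_le_or_EInterp hM k) i j).and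
    (BoolComb.rel (isGood_le_or_EInterp hM k) j i)).congr fun v => ⟨?_, fun h => ?_⟩
  · rintro ⟨h | h, h' | h'⟩
    · rw [le_antisymm h h']
      exact hr.refl _
    · exact hr.symm h'
    · exact h
    · exact h
  · exact ⟨Or.inr h, Or.inr (hr.symm h)⟩

/-- Successor classes are first-order definable from `<` and `E_k`, so closure under quantifiers
covers them. -/
theorem boolComb_RInterp (hM : IsNamedCcelSucc I J M) (n : ℤ) (k : J) (i j : ι) :
    BoolComb (ccelSuccLanguage I J) fun v : ι → M => RInterp I M n k (v i) (v j) := by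
  have hl : BoolComb (ccelSuccLanguage I J) fun v : ι → M => LtSucc (EInterp I M k) n (v i) (v j) :=
    BoolComb.ltSucc (boolComb_lt hM) (boolComb_EInterp hM k) n i j
  rcases lt_or_ge n 0 with hn | hn
  · exact hl.congr fun v => (hM.R_neg n k hn _ _).symm
  · exact (hl.or (BoolComb.succClass (boolComb_lt hM) (boolComb_EInterp hM k) n j i)).congr
      fun v => (hM.R_nonneg n k hn _ _).symm

theorem term_eq_var {α : Type*} (t : (ccelSuccLanguage I J).Term α) :
    ∃ i, t = Language.Term.var i := by
  cases t with
  | var i => exact ⟨i, rfl⟩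
  | func f _ => exact Empty.elim f

theorem boolComb_realize (hM : IsNamedCcelSucc I J M) {n : ℕ}
    (φ : (ccelSuccLanguage I J).BoundedFormula ι n) :
    BoolComb (ccelSuccLanguage I J) fun v : ι ⊕ Fin n → M =>
      φ.Realize (fun i => v (Sum.inl i)) fun i => v (Sum.inr i) := by
  have helim : ∀ {n} (v : ι ⊕ Fin n → M),
      Sum.elim (fun i => v (Sum.inl i)) (fun i => v (Sum.inr i)) = v := fun v =>
    Sum.elim_comp_inl_inr v
  induction φ with
  | falsum => exact .false
  | equal t₁ t₂ =>
    obtain ⟨i, rfl⟩ := term_eq_var t₁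
    obtain ⟨j, rfl⟩ := term_eq_var t₂
    refine (boolComb_eq hM i j).congr fun v => ?_
    simp only [Language.BoundedFormula.Realize, helim, Language.Term.realize_var]
  | @rel n l R ts =>
    choose f hf using fun i => term_eq_var (ts i)
    have hts : ∀ v : ι ⊕ Fin n → M, (Language.BoundedFormula.rel R ts).Realize
        (fun i => v (Sum.inl i)) (fun i => v (Sum.inr i)) ↔
        Language.Structure.RelMap R fun i => v (f i) := fun v => by
      simp only [Language.BoundedFormula.Realize, helim, hf, Language.Term.realize_var]
    have h₂ : ∀ (g : Fin 2 → ι ⊕ Fin n) (v : ι ⊕ Fin n → M),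
        ![v (g 0), v (g 1)] = fun i => v (g i) := fun g v => by
      ext i; fin_cases i <;> rfl
    cases R with
    | lt =>
      refine (boolComb_lt hM (f 0) (f 1)).congr fun v => ?_
      rw [hts, ← h₂, ← hM.lt_iff]; rfl
    | P i =>
      refine (BoolComb.unary (isDef₁_rel (L := ccelSuccLanguage I J) (CcelSuccRel.P i))
        (f 0)).congr fun v => ?_
      rw [hts]
      exact iff_of_eq (congrArg _ (by ext i; fin_cases i; rfl))
    | E k =>
      refine (boolComb_EInterp hM k (f 0) (f 1)).congr fun v => ?_
      rw [hts, ← h₂]; rfl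
    | R m k =>
      refine (boolComb_RInterp hM m k (f 0) (f 1)).congr fun v => ?_
      rw [hts, ← h₂]; rfl
  | imp _ _ h₁ h₂ => exact h₁.imp h₂
  | @all n φ ih =>
    refine (BoolComb.all (Q := fun v z => φ.Realize (fun i => v (Sum.inl i))
      (Fin.snoc (fun i => v (Sum.inr i)) z)) ((ih.reindex (Sum.elim (fun i => some (Sum.inl i))
        (Fin.snoc (α := fun _ => Option (ι ⊕ Fin n)) (fun i => some (Sum.inr i)) none))).congr
          fun v => ?_))
    refine iff_of_eq (congrArg _ (funext fun i => ?_))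
    refine Fin.lastCases ?_ (fun i => ?_) i <;> simp

theorem isQFDef_unary (hM : IsNamedCcelSucc I J M) {P : M → Prop}
    (hP : IsDef₁ (ccelSuccLanguage I J) P) (i : ι) :
    IsQFDef (ccelSuccLanguage I J) fun v : ι → M => P (v i) := by
  obtain ⟨k, hk⟩ := hM.named_unary {x | P x} hP.definable₁
  have hk' : ∀ x, Language.Structure.RelMap (L := ccelSuccLanguage I J) (CcelSuccRel.P k) ![x] ↔
      P x :=
    fun x => iff_of_eq (congrArg (x ∈ ·) hk)
  simpa only [hk'] using isQFDef_rel₁ (L := ccelSuccLanguage I J) (M := M) (CcelSuccRel.P k) i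

theorem isQFDef_lt (hM : IsNamedCcelSucc I J M) (i j : ι) :
    IsQFDef (ccelSuccLanguage I J) fun v : ι → M => v i < v j := by
  have := isQFDef_rel₂ (L := ccelSuccLanguage I J) (M := M) CcelSuccRel.lt i j
  simpa only [← ltInterp.eq_def, hM.lt_iff] using this

theorem isQFDef_of_lt (hM : IsNamedCcelSucc I J M) {A : M → M → Prop}
    (hA : IsGood (ccelSuccLanguage I J) A) (i j : ι) :
    IsQFDef (ccelSuccLanguage I J) fun v : ι → M =>
      v i < v j ∧ A (v i) (v j) := by
  set F : M → M → Prop := fun x z => z ≤ x ∨ A x z with hFdef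
  have hFd : IsDef₂ (ccelSuccLanguage I J) F := IsDef.or (isDef₂_le hM) hA.isDef
  have hF : IsMonotoneRel F := fun _ _ _ _ hx hz h =>
    h.imp (fun h => hz.trans (h.trans hx)) (hA.mono hx hz)
  obtain ⟨N, hN⟩ := hA.isLocal
  have hN' := interlaced_le_or_bounded hA.mono fun x z h => (hN x z h).1
  obtain ⟨k, hk⟩ := hM.named_convexEquiv _ (isConvexEquiv_kernelRel hF) hFd.kernelRel.definable₂
  have hR : ∀ n : ℕ, IsQFDef (ccelSuccLanguage I J) fun v : ι → M =>
      LeSucc (kernelRel F) n (v j) (v i) := fun n => by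
    have := isQFDef_rel₂ (L := ccelSuccLanguage I J) (M := M) (CcelSuccRel.R n k) j i
    simpa only [← RInterp.eq_def, hM.R_nonneg n k (Int.natCast_nonneg n), hk] using this
  -- The index `n` of the last class depends on `v i`, but takes boundedly many values, each on a
  -- definable and hence named set.
  have hQ := (isQFDef_lt hM i j).and (IsQFDef.exists_lt (fun n =>
    (isQFDef_unary hM (isDef₁_lastClass (isDef₂_lt hM) hFd n) i).and (hR n)) (2 * (N + 1 + 2)))
  convert hQ using 2 with v
  refine and_congr_right fun hlt => ?_
  have hAF : A (v i) (v j) ↔ F (v i) (v j) := by simp [hFdef, not_le.2 hlt]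
  rw [hAF]
  constructor
  · intro h
    obtain ⟨n, hn, z, hz⟩ := exists_lastClass hF (fun x => Or.inl le_rfl) hN' (v i)
    exact ⟨n, hn, ⟨z, hz⟩, (hz.iff_leSucc hF _).1 h⟩
  · rintro ⟨n, -, ⟨z, hz⟩, h⟩
    exact (hz.iff_leSucc hF _).2 h

theorem isQFDef_of_isGood (hM : IsNamedCcelSucc I J M) {A : M → M → Prop}
    (hA : IsGood (ccelSuccLanguage I J) A) (i j : ι) :
    IsQFDef (ccelSuccLanguage I J) fun v : ι → M => A (v i) (v j) := by
  -- For `v j < v i`, the relation `A (v i) (v j)` is the negation of the dual at the increasing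
  -- pair `(v j, v i)`; on the diagonal `A` is a unary predicate.
  have hgt := ((isQFDef_of_lt hM hA.dual j i).not).and (isQFDef_lt hM j i)
  have heq := ((isQFDef_lt hM i j).or (isQFDef_lt hM j i)).not.and
    (isQFDef_unary hM hA.isDef.diag i)
  convert (isQFDef_of_lt hM hA i j).or (hgt.or heq) using 2 with v
  rcases lt_trichotomy (v i) (v j) with h | h | h
  · simp [h, h.not_gt]
  · simp [h]
  · simp [h, h.not_gt]

theorem BoolComb.isQFDef (hM : IsNamedCcelSucc I J M) {q : (ι → M) → Prop}
    (h : BoolComb (ccelSuccLanguage I J) q) : IsQFDef (ccelSuccLanguage I J) q := by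
  induction h with
  | unary hP i => exact isQFDef_unary hM hP i
  | rel hA i j => exact isQFDef_of_isGood hM hA i j
  | false => exact isQFDef_false
  | imp _ _ h₁ h₂ => exact h₁.imp h₂

end Named
end CcelSucc

theorem mainTheorem4 {I J M : Type*} [LinearOrder M] [(ccelSuccLanguage I J).Structure M]
    (hM : IsNamedCcelSucc I J M) :
    EliminatesQuantifiers ((ccelSuccLanguage I J).completeTheory M) := by
  intro n φ
  obtain ⟨ψ, hψ, h⟩ := ((CcelSucc.boolComb_realize hM φ).reindex
    (Sum.elim id Fin.elim0)).isQFDef hM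
  refine ⟨ψ, hψ, CcelSucc.completeTheory_iff_of_realize_iff fun v => ?_⟩
  rw [h, Language.Formula.Realize]
  exact iff_of_eq (congrArg _ (Subsingleton.elim _ _))
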